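/- Let $K$ be a field and let $K_0(\mathcal V_K)$ be the Grothendieck ring of varieties over $K$: the abelian group generated by isomorphism classes $[X]$ of varieties (separated schemes of finite type) over $K$, modulo the relations $[X]=[Y]+[X\smallsetminus Y]$ for $Y\subset X$ closed, with product $[X][Y]=[X\times_K Y]$. Let $\mathbb T=[\mathbb A^1]-[\mathbb A^0]$, the class of the multiplicative group. For $n\ge 2$ let $\Gamma_n$ be the $n$-th banana graph, i.e. the graph with two vertices and $n$ parallel edges between them, let $$\Psi_{\Gamma_n}(t)=\sum_{T}\ \prod_{e\notin E(T)}t_e\in K[t_1,\dots,t_n]$$ (sum over the spanning trees $T$ of $\Gamma_n$) be its Kirchhoff polynomial, and let $X_{\Gamma_n}=\{\Psi_{\Gamma_n}=0\}\subset\mathbb P^{n-1}$. Then, in $K_0(\mathcal V_K)$, $$[\mathbb P^{n-1}\smallsetminus X_{\Gamma_n}]=\frac{\mathbb T^n-(-1)^n}{\mathbb T+1}+n\,\mathbb T^{n-2}=\mathbb T^{n-1}+(n-1)\mathbb T^{n-2}+\sum_{k=0}^{n-3}(-1)^{n-3-k}\,\mathbb T^{k},$$ where the fraction denotes the value at $\mathbb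 T$ of the polynomial $q\in\mathbb Z[x]$ with $(x+1)\,q=x^n-(-1)^n$ (so the last expression is $\mathbb T^{n-1}+(n-1)\mathbb T^{n-2}+\mathbb T^{n-3}-\mathbb T^{n-4}+\cdots\pm1$). In terms of classes of projective spaces, $$[\mathbb P^{n-1}\smallsetminus X_{\Gamma_n}]=\sum_{k=0}^{n-1}\binom{n+1}{k+2}(-1)^{n-1-k}\,[\mathbb P^k]+n\sum_{k=0}^{n-2}\binom{n-1}{k+1}(-1)^{n-2-k}\,[\mathbb P^k].$$ -/

import Mathlib

open CategoryTheory AlgebraicGeometry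

universe u

noncomputable section

namespace BananaMotive

/-! ### The Grothendieck ring of varieties -/

/-- A variety over `K`: a separated scheme of finite type over `Spec K`. -/
def IsVariety (K : Type u) [Field K] :
    ObjectProperty (Over (Spec (CommRingCat.of K))) :=
  fun X => IsSeparated X.hom ∧ LocallyOfFiniteType X.hom ∧ QuasiCompact X.hom

/-- Varieties over `K` contain the point and are stable under fibre products over `Spec K`. -/
instance isMonoidal_isVariety (K : Type u) [Field K] : (IsVariety K).IsMonoidal where
  prop_unit := by
    exact ⟨inferInstanceAs (IsSeparated (𝟙 (Spec (CommRingCat.of K)))),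
      inferInstanceAs (LocallyOfFiniteType (𝟙 (Spec (CommRingCat.of K)))),
      inferInstanceAs (QuasiCompact (𝟙 (Spec (CommRingCat.of K))))⟩
  prop_tensor X Y := by
    rintro ⟨h₁, h₂, h₃⟩ ⟨h₄, h₅, h₆⟩
    exact ⟨inferInstanceAs (IsSeparated (Limits.pullback.fst X.hom Y.hom ≫ X.hom)),
      inferInstanceAs (LocallyOfFiniteType (Limits.pullback.fst X.hom Y.hom ≫ X.hom)),
      inferInstanceAs (QuasiCompact (Limits.pullback.fst X.hom Y.hom ≫ X.hom))⟩

/-- The category of varieties over `K` and morphisms over `K`;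
its monoidal structure is the product over `K`. -/
abbrev Var (K : Type u) [Field K] : Type (u + 1) := (IsVariety K).FullSubcategory

/-- The commutative monoid of isomorphism classes of varieties over `K`, with `[X][Y] = [X × Y]`. -/
abbrev VarClass (K : Type u) [Field K] : Type (u + 1) := Skeleton (Var K)

/-- The generator attached to the isomorphism class of a variety. -/
def gen {K : Type u} [Field K] (X : Var K) : FreeAbelianGroup (VarClass K) :=
  FreeAbelianGroup.of (toSkeleton X)

/-- The elements `[X] - [Z] - [X ∖ Z]`, for `X` a variety and `Z` a closed subvariety:
`Z` is given by a closed immersion into `X`, and `X ∖ Z` by an open immersion onto the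
complement of its image. -/
def scissorRelations (K : Type u) [Field K] : Set (FreeAbelianGroup (VarClass K)) :=
  {r | ∃ (X Z U : Var K) (i : Z.obj ⟶ X.obj) (j : U.obj ⟶ X.obj),
    IsClosedImmersion i.left ∧ IsOpenImmersion j.left ∧
      Set.range j.left = (Set.range i.left)ᶜ ∧ r = gen X - gen Z - gen U}

/-- The Grothendieck ring `K₀(𝒱_K)` of varieties over `K`. The product of the free abelian group on
isomorphism classes is the bilinear extension of `[X][Y] = [X × Y]`. -/
abbrev GrothendieckRing (K : Type u) [Field K] : Type (u + 1) :=
  FreeAbelianGroup (VarClass K) ⧸ Ideal.span (scissorRelations K)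

/-- The class `[X]` of a variety. -/
def classOf {K : Type u} [Field K] (X : Var K) : GrothendieckRing K :=
  Ideal.Quotient.mk _ (gen X)

/-! ### Affine and projective spaces -/

/-- Affine space `𝔸^d` over `K`. -/
def affineSpace (K : Type u) [Field K] (d : ℕ) : Var K where
  obj := Over.mk (𝔸(ULift.{u} (Fin d); Spec (CommRingCat.of K)) ↘ Spec (CommRingCat.of K))
  property := ⟨by dsimp; infer_instance, by dsimp; infer_instance, by dsimp; infer_instance⟩

/-- `𝕋 = [𝔸¹] - [𝔸⁰]`, the class of the multiplicative group. -/
def torusClass (K : Type u) [Field K] : GrothendieckRing K :=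
  classOf (affineSpace K 1) - classOf (affineSpace K 0)

/-- The polynomial ring `K[t_1, …, t_m]` graded by degree. -/
abbrev grading (K : Type u) [Field K] (m : ℕ) :
    ℕ → Submodule K (MvPolynomial (Fin m) K) :=
  MvPolynomial.homogeneousSubmodule (Fin m) K

instance gradedAlgebra_grading (K : Type u) [Field K] (m : ℕ) : GradedAlgebra (grading K m) :=
  MvPolynomial.gradedAlgebra

/-- The scheme `Proj K[t_1, …, t_m]`, i.e. the projective space of dimension `m - 1`, with
homogeneous coordinates `t_1, …, t_m`. -/
abbrev projScheme (K : Type u) [Field K] (m : ℕ) : Scheme.{u} := Proj (grading K m)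

/-- The structure morphism to `Spec K`. -/
def projStructure (K : Type u) [Field K] (m : ℕ) :
    projScheme K m ⟶ Spec (CommRingCat.of K) :=
  Proj.toSpecZero (grading K m) ≫
    Spec.map (CommRingCat.ofHom (algebraMap K (grading K m 0)))

lemma finiteType_grading_zero (K : Type u) [Field K] (m : ℕ) :
    Algebra.FiniteType (grading K m 0) (MvPolynomial (Fin m) K) :=
  have := IsScalarTower.of_algebraMap_eq (R := K) (S := grading K m 0)
    (A := MvPolynomial (Fin m) K) fun _ => rfl
  Algebra.FiniteType.of_restrictScalars_finiteType K _ _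

lemma algebraMap_grading_zero_surjective (K : Type u) [Field K] (m : ℕ) :
    Function.Surjective (algebraMap K (grading K m 0)) := by
  rintro ⟨p, hp⟩
  have hp' : p.totalDegree = 0 := Nat.le_zero.mp (MvPolynomial.IsHomogeneous.totalDegree_le hp)
  refine ⟨p.coeff 0, Subtype.ext ?_⟩
  exact (MvPolynomial.totalDegree_eq_zero_iff_eq_C.mp hp').symm

lemma isVariety_proj (K : Type u) [Field K] (m : ℕ) :
    IsVariety K (Over.mk (projStructure K m)) := by
  have h := finiteType_grading_zero K m
  have h' : IsClosedImmersion
      (Spec.map (CommRingCat.ofHom (algebraMap K (grading K m 0)))) :=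
    IsClosedImmersion.spec_of_surjective _ (algebraMap_grading_zero_surjective K m)
  refine ⟨?_, ?_, ?_⟩ <;>
  · dsimp [projStructure]
    infer_instance

/-- An open subset of `Proj K[t_1, …, t_m]`, as a variety over `K`. -/
def openSubvariety (K : Type u) [Field K] (m : ℕ) (U : (projScheme K m).Opens) : Var K where
  obj := Over.mk (U.ι ≫ projStructure K m)
  property := by
    obtain ⟨h₁, h₂, h₃⟩ := isVariety_proj K m
    dsimp at h₁ h₂ h₃
    have : IsLocallyNoetherian (projScheme K m) :=
      LocallyOfFiniteType.isLocallyNoetherian (projStructure K m)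
    refine ⟨?_, ?_, ?_⟩ <;>
    · dsimp
      infer_instance

/-- Projective space `ℙ^r` over `K`. -/
def projectiveSpace (K : Type u) [Field K] (r : ℕ) : Var K where
  obj := Over.mk (projStructure K (r + 1))
  property := isVariety_proj K (r + 1)

/-- The zero locus `{Ψ = 0}` in `Proj K[t_1, …, t_m]`. -/
def hypersurface {K : Type u} [Field K] {m : ℕ} (Ψ : MvPolynomial (Fin m) K) :
    Set (projScheme K m) :=
  ProjectiveSpectrum.zeroLocus (grading K m) {Ψ}

/-- The complement of the zero locus `{Ψ = 0}` in `Proj K[t_1, …, t_m]`, as a variety. -/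
def hypersurfaceComplement {K : Type u} [Field K] {m : ℕ} (Ψ : MvPolynomial (Fin m) K) : Var K :=
  openSubvariety K m
    ⟨(hypersurface Ψ)ᶜ,
      (ProjectiveSpectrum.isClosed_zeroLocus (grading K m) {Ψ}).isOpen_compl⟩

/-! ### Graph polynomials -/

open scoped Graph in
/-- `H` is a spanning tree of the multigraph `G`: a subgraph with the same vertices, without loops
and parallel edges, and whose underlying simple graph is a tree. -/
def IsSpanningTree {α β : Type*} (H G : Graph α β) : Prop :=
  H ≤s G ∧ H.Simple ∧ H.toSimpleGraph.IsTree

open scoped Graph Classical in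
/-- The Kirchhoff polynomial `∑_T ∏_{e ∉ E(T)} t_e` of a multigraph, the sum being over all its
spanning trees `T`, each of which is determined by its set `S` of edges. -/
def kirchhoffPolynomial (K : Type u) [Field K] {α β : Type*} [Fintype β] (G : Graph α β) :
    MvPolynomial β K :=
  ∑ S ∈ (Finset.univ : Finset (Finset β)).filter
      (fun S : Finset β => ∃ T : Graph α β, IsSpanningTree T G ∧ E(T) = (↑S : Set β)),
    ∏ e ∈ (Finset.univ : Finset β).filter (fun e : β => e ∈ E(G) ∧ e ∉ S), MvPolynomial.X e

/-- The banana graph `Γ_n`: two vertices and `n` parallel edges between them. -/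
def bananaGraph (n : ℕ) : Graph (Fin 2) (Fin n) := Graph.banana 0 1 Set.univ

/-- The variety `ℙ^{n-1} ∖ X_{Γ_n}`, where `X_{Γ_n}` is the hypersurface defined by the
Kirchhoff polynomial of `Γ_n`. -/
def bananaComplement (K : Type u) [Field K] (n : ℕ) : Var K :=
  hypersurfaceComplement (kirchhoffPolynomial K (bananaGraph n))

end BananaMotive

end

/-! A spanning tree of `Γ_n` is a single edge, so the Kirchhoff polynomial is the elementary
symmetric polynomial of degree `n - 1`, `almostProd X`. Its complement is cut by coordinate
hyperplanes. Put `n = m + 2`. Setting one coordinate to `1` gives `D_{m+1} = e_m + e_{m+1}` in `m +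
1` variables, and `D_{m+1} = x_0 D_m + x_1 ⋯ x_m`. Inside the torus the zero locus of `D_{m+1}` is
therefore the graph of `x_0 = -x_1 ⋯ x_m / D_m` over the part of the smaller torus where `D_m ≠ 0`.
The classes `a_m` of `{D_m ≠ 0}` in the tori thus satisfy `a_{m+1} = 𝕋^{m+1} - a_m`
(`locClass_prod_X_mul_dehomogenized`), which sums to the fraction in the theorem. On a hyperplane
`x_p = 0`, `D_{m+1}` becomes the product of the other variables, so each of the `m + 1` affine
hyperplanes contributes a torus `𝕋^m` (`locClass_dehomogenized`); so does the hyperplane at infinity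
(`classOf_almostProdOpen`). This yields `n 𝕋^{n-2}`. For the last formula, `[ℙ^k] = ∑ (𝕋 + 1)^i`
(`classOf_projectiveSpace`) reduces the claim to identities in `ℤ[X]`, evaluated at `𝕋`. -/

noncomputable section

namespace BananaMotive

/-! ### Scissor relations and products in the Grothendieck ring. -/

variable {K : Type u} [Field K]

/-- Varieties which are isomorphic over `K` have the same class. -/
lemma classOf_eq_of_iso {X Y : Var K} (e : X.obj ≅ Y.obj) : classOf X = classOf Y :=
  congrArg (fun x => Ideal.Quotient.mk _ (FreeAbelianGroup.of x))
    (congr_toSkeleton_of_iso ((IsVariety K).fullyFaithfulι.preimageIso e))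

lemma classOf_eq_add {X Z U : Var K} (i : Z.obj ⟶ X.obj) (j : U.obj ⟶ X.obj)
    (hi : IsClosedImmersion i.left) (hj : IsOpenImmersion j.left)
    (h : Set.range j.left = (Set.range i.left)ᶜ) : classOf X = classOf Z + classOf U := by
  rw [← sub_eq_zero, ← sub_sub]
  exact Ideal.Quotient.eq_zero_iff_mem.mpr
    (Ideal.subset_span ⟨X, Z, U, i, j, hi, hj, h, rfl⟩)

lemma classOf_tensor (X Y : Var K) :
    classOf (MonoidalCategory.tensorObj X Y) = classOf X * classOf Y := by
  simp only [classOf, gen, Skeleton.toSkeleton_tensorObj, ← map_mul]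
  rfl

lemma classOf_unit : classOf (MonoidalCategory.tensorUnit (Var K)) = 1 := rfl

/-- The class of an empty variety vanishes. -/
lemma classOf_eq_zero (X : Var K) [h : IsEmpty X.obj.left] : classOf X = 0 := by
  -- On an empty space the identity is complementary to itself, which gives `[X] = [X] + [X]`.
  have := classOf_eq_add (𝟙 X.obj) (𝟙 X.obj) (by dsimp; infer_instance) (by dsimp; infer_instance)
    (Set.ext fun x => (h.false x).elim)
  simpa using this

/-- If `Z` is immersed in projective space with image `V ∖ U`, then `[V] = [U] + [Z]`. -/
lemma classOf_openSubvariety_eq_add {m : ℕ} {U V : (projScheme K m).Opens} (hUV : U ≤ V)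
    (Z : Var K) (g : Z.obj.left ⟶ projScheme K m) (hg : g ≫ projStructure K m = Z.obj.hom)
    [IsImmersion g] (hr : Set.range g = (V : Set (projScheme K m)) \ U) :
    classOf (openSubvariety K m V) = classOf (openSubvariety K m U) + classOf Z := by
  have hV : Set.range g ⊆ Set.range V.ι := by
    rw [hr, Scheme.Opens.range_ι]; exact Set.sdiff_subset
  let i' : Z.obj.left ⟶ V := IsOpenImmersion.lift V.ι g hV
  have hi' : i' ≫ V.ι = g := IsOpenImmersion.lift_fac _ _ _
  have hrange : Set.range i' = V.ι ⁻¹' Set.range g := by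
    have : Set.range g = V.ι '' Set.range i' := by
      rw [← hi', ← Set.range_comp]; rfl
    rw [this, Set.preimage_image_eq _ V.ι.isOpenEmbedding.injective]
  have hi₁ : IsImmersion i' := by
    have : IsImmersion (i' ≫ V.ι) := by rw [hi']; infer_instance
    exact IsImmersion.of_comp i' V.ι
  have hrange' : Set.range i' = (V.ι ⁻¹' (U : Set (projScheme K m)))ᶜ := by
    rw [hrange, hr]
    ext x
    exact ⟨fun h => h.2, fun h => ⟨x.2, h⟩⟩
  -- An immersion with closed range is a closed immersion; inside `V` the range is the complement of
  -- the open set `U`.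
  have hi₂ : IsClosedImmersion i' := by
    refine IsClosedImmersion.of_isPreimmersion i' ?_
    rw [hrange']
    exact (U.isOpen.preimage V.ι.continuous).isClosed_compl
  rw [add_comm]
  refine classOf_eq_add (X := openSubvariety K m V) (U := openSubvariety K m U)
    (Over.homMk i' ?_) (Over.homMk ((projScheme K m).homOfLE hUV) ?_) hi₂
    (show IsOpenImmersion ((projScheme K m).homOfLE hUV) from inferInstance) ?_
  · change i' ≫ V.ι ≫ _ = _
    rw [← Category.assoc, hi', hg]
  · change _ ≫ V.ι ≫ _ = U.ι ≫ _
    simp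
  · change Set.range ((projScheme K m).homOfLE hUV) = (Set.range i')ᶜ
    rw [hrange', compl_compl]
    have : (U : Set (projScheme K m)) = V.ι '' Set.range ((projScheme K m).homOfLE hUV) := by
      rw [← Set.range_comp]
      conv_lhs => rw [← Scheme.Opens.range_ι U, ← (projScheme K m).homOfLE_ι hUV]
      rfl
    conv_rhs => rw [this, Set.preimage_image_eq _ V.ι.isOpenEmbedding.injective]

lemma classOf_openSubvariety_bot (m : ℕ) : classOf (openSubvariety K m ⊥) = 0 :=
  have : IsEmpty (openSubvariety K m ⊥).obj.left :=
    ⟨fun x : (⊥ : (projScheme K m).Opens) => x.2⟩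
  classOf_eq_zero _

lemma classOf_openSubvariety_top (r : ℕ) :
    classOf (openSubvariety K (r + 1) ⊤) = classOf (projectiveSpace K r) :=
  classOf_eq_of_iso (Over.isoMk (Scheme.topIso _) (by rfl))

/-! ### Classes of affine varieties. -/

section affine

variable (K)
variable (A : Type u) [CommRing A] [Algebra K A] [Algebra.FiniteType K A]

/-- The spectrum of a `K`-algebra of finite type, as a variety. -/
def specVar : Var K where
  obj := Over.mk (Spec.map (CommRingCat.ofHom (algebraMap K A)))
  property := by
    have : LocallyOfFiniteType (Spec.map (CommRingCat.ofHom (algebraMap K A))) := by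
      rw [HasRingHomProperty.Spec_iff (P := @LocallyOfFiniteType)]
      exact (RingHom.finiteType_algebraMap).mpr inferInstance
    exact ⟨by dsimp; infer_instance, this, by dsimp; infer_instance⟩

/-- The class of the spectrum of a `K`-algebra of finite type. -/
def specClass : GrothendieckRing K := classOf (specVar K A)

variable {K A}
variable {B : Type u} [CommRing B] [Algebra K B] [Algebra.FiniteType K B]

/-- The morphism of spectra over `K` induced by a morphism of `K`-algebras. -/
def specHom (φ : A →ₐ[K] B) : (specVar K B).obj ⟶ (specVar K A).obj :=
  Over.homMk (Spec.map (CommRingCat.ofHom φ.toRingHom)) (by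
    dsimp [specVar]
    rw [← Spec.map_comp, ← CommRingCat.ofHom_comp]
    congr 2
    exact φ.comp_algebraMap)

lemma specClass_congr (e : A ≃ₐ[K] B) : specClass K A = specClass K B :=
  (classOf_eq_of_iso (X := specVar K B) (Y := specVar K A)
    (Over.isoMk (Scheme.Spec.mapIso e.toRingEquiv.toCommRingCatIso.op)
      (Over.w (specHom e.toAlgHom)))).symm

/-- The scissor relation for the locus `f = 0` in an affine variety. -/
lemma specClass_eq_quotient_add_localization (f : A) :
    specClass K A = specClass K (A ⧸ Ideal.span {f}) + specClass K (Localization.Away f) := by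
  refine classOf_eq_add (specHom (Ideal.Quotient.mkₐ K (Ideal.span {f})))
    (specHom (IsScalarTower.toAlgHom K A (Localization.Away f)))
    (IsClosedImmersion.spec_of_surjective _ Ideal.Quotient.mk_surjective)
    (inferInstanceAs (IsOpenImmersion
      (Spec.map (CommRingCat.ofHom (algebraMap A (Localization.Away f)))))) ?_
  have h₁ := PrimeSpectrum.localization_away_comap_range (Localization.Away f) f
  have h₂ := range_comap_of_surjective (A ⧸ Ideal.span {f})
    (Ideal.Quotient.mk (Ideal.span {f})) Ideal.Quotient.mk_surjective
  refine h₁.trans ?_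
  rw [Ideal.mk_ker, PrimeSpectrum.zeroLocus_span] at h₂
  exact (PrimeSpectrum.basicOpen_eq_zeroLocus_compl f).trans (congrArg compl h₂.symm)

/-- The class of a product of affine varieties. -/
lemma specClass_tensor [Algebra.FiniteType K (TensorProduct K A B)] :
    specClass K (TensorProduct K A B) = specClass K A * specClass K B := by
  rw [specClass, specClass, specClass, ← classOf_tensor]
  refine classOf_eq_of_iso (Over.isoMk (pullbackSpecIso K A B).symm ?_)
  dsimp [specVar]
  exact pullbackSpecIso_inv_fst_assoc K A B _ |>.trans (Spec.map_comp _ _).symm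

lemma specClass_field : specClass K K = 1 := by
  rw [← classOf_unit]
  refine classOf_eq_of_iso (Over.isoMk (Iso.refl (Spec (CommRingCat.of K))) ?_)
  exact (Category.id_comp _).trans (Spec.map_id _).symm

lemma specClass_eq_zero [Subsingleton A] : specClass K A = 0 :=
  have : IsEmpty (specVar K A).obj.left := inferInstanceAs (IsEmpty (PrimeSpectrum A))
  classOf_eq_zero _

lemma classOf_affineSpace (d : ℕ) :
    classOf (affineSpace K d) = specClass K (MvPolynomial (ULift.{u} (Fin d)) K) := by
  refine (classOf_eq_of_iso (Over.isoMk
    (AffineSpace.SpecIso (ULift.{u} (Fin d)) (CommRingCat.of K)).symm ?_)).symm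
  exact AffineSpace.SpecIso_inv_over _

end affine

/-! ### Classes of principal open subsets. -/

section localization

variable {K : Type u} [Field K]
variable {A : Type u} [CommRing A] [Algebra K A] [Algebra.FiniteType K A]
variable {B : Type u} [CommRing B] [Algebra K B] [Algebra.FiniteType K B]

variable (K) in
/-- The class of the locus `f ≠ 0` in the spectrum of `A`. -/
def locClass (f : A) : GrothendieckRing K := specClass K (Localization.Away f)

lemma specClass_eq_locClass (f : A) (S : Type u) [CommRing S] [Algebra K S] [Algebra A S]
    [IsScalarTower K A S] [Algebra.FiniteType K S] [IsLocalization.Away f S] :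
    specClass K S = locClass K f :=
  specClass_congr
    ((IsLocalization.algEquiv (Submonoid.powers f) S (Localization.Away f)).restrictScalars K)

lemma locClass_map_equiv (e : A ≃ₐ[K] B) (f : A) : locClass K (e f) = locClass K f := by
  have H : (Submonoid.powers f).map e.toRingEquiv.toMonoidHom = Submonoid.powers (e f) :=
    Submonoid.map_powers _ _
  refine (specClass_congr (AlgEquiv.ofRingEquiv
    (f := IsLocalization.ringEquivOfRingEquiv (Localization.Away f) (Localization.Away (e f))
      e.toRingEquiv H) fun x => ?_)).symm
  rw [IsScalarTower.algebraMap_apply K A, IsLocalization.ringEquivOfRingEquiv_eq,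
    IsScalarTower.algebraMap_apply K B (Localization.Away (e f))]
  exact congrArg _ (e.commutes x)

lemma locClass_one : locClass K (1 : A) = specClass K A :=
  (specClass_congr ((IsLocalization.atOne A (Localization.Away (1 : A))).restrictScalars K)).symm

lemma specClass_eq_add (φ : A →ₐ[K] B) (hφ : Function.Surjective φ) (g : A)
    (hg : RingHom.ker φ = Ideal.span {g}) :
    specClass K A = specClass K B + locClass K g := by
  rw [specClass_eq_quotient_add_localization g]
  congr 1
  exact specClass_congr ((Ideal.quotientEquivAlgOfEq K hg.symm).trans
    (Ideal.quotientKerAlgEquivOfSurjective hφ))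

lemma locClass_algebraMap (f g : A) :
    locClass K (algebraMap A (Localization.Away f) g) = locClass K (f * g) :=
  specClass_eq_locClass (f * g) (Localization.Away (algebraMap A (Localization.Away f) g))

/-- The scissor relation for the locus `g = 0` in `{f ≠ 0}`. -/
lemma locClass_eq_add (φ : A →ₐ[K] B) (hφ : Function.Surjective φ) (f g : A)
    (hg : RingHom.ker φ = Ideal.span {g}) :
    locClass K f = locClass K (φ f) + locClass K (f * g) := by
  rw [← locClass_algebraMap f g]
  refine specClass_eq_add
    (IsLocalization.Away.mapₐ (Localization.Away f) (Localization.Away (φ f)) φ f)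
    (IsLocalization.Away.mapₐ_surjective_of_surjective f hφ) _ ?_
  have h := IsLocalization.ker_map (S := Localization.Away f) (M := Submonoid.powers f)
    (T := Submonoid.powers (φ f)) (Localization.Away (φ f)) (φ : A →+* B)
    (Submonoid.map_powers _ _)
  refine Eq.trans h ?_
  rw [show RingHom.ker (φ : A →+* B) = Ideal.span {g} from hg, Ideal.map_span,
    Set.image_singleton]

/-- Where `f` is invertible so is `g`: the stratum `g = 0` is empty because `f` becomes nilpotent
modulo `g`. -/
lemma locClass_mul_of_dvd_pow (f g : A) (n : ℕ) (h : g ∣ f ^ n) :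
    locClass K (f * g) = locClass K f := by
  have h0 := locClass_eq_add (K := K) (Ideal.Quotient.mkₐ K (Ideal.span {g}))
    Ideal.Quotient.mk_surjective f g (Ideal.Quotient.mkₐ_ker K _)
  have : Subsingleton (Localization.Away (Ideal.Quotient.mkₐ K (Ideal.span {g}) f)) := by
    refine IsLocalization.subsingleton
      (M := Submonoid.powers (Ideal.Quotient.mkₐ K (Ideal.span {g}) f)) ⟨n, ?_⟩
    change _ ^ n = 0
    rw [← map_pow]
    exact Ideal.Quotient.eq_zero_iff_mem.mpr (Ideal.mem_span_singleton.mpr h)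
  have h1 : locClass K (Ideal.Quotient.mkₐ K (Ideal.span {g}) f) = 0 := specClass_eq_zero
  rw [h0, h1, zero_add]

open Polynomial

-- The locus is a product with the affine line: `A_a[X]` is both the localization of `A[X]` at `C a`
-- and `A_a ⊗ K[X]`.
attribute [local instance] Polynomial.algebra in
lemma locClass_C (a : A) :
    locClass K (C a) = specClass K K[X] * locClass K a := by
  have h : IsLocalization.Away (C a) (Localization.Away a)[X] := by
    have := Polynomial.isLocalization (Submonoid.powers a) (Localization.Away a)
    rwa [Submonoid.map_powers] at this
  have : IsScalarTower K A[X] (Localization.Away a)[X] := by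
    refine IsScalarTower.of_algebraMap_eq fun x => ?_
    rw [Polynomial.algebraMap_apply, Polynomial.algebraMap_apply,
      Polynomial.algebraMap_def, Polynomial.coe_mapRingHom, Polynomial.map_C,
      ← IsScalarTower.algebraMap_apply]
  have := Algebra.FiniteType.equiv (inferInstanceAs (Algebra.FiniteType K (Localization.Away a)[X]))
    (polyEquivTensor K (Localization.Away a))
  rw [← specClass_eq_locClass (C a) (Localization.Away a)[X], mul_comm, locClass,
    ← specClass_tensor]
  exact specClass_congr (polyEquivTensor K (Localization.Away a))

/-- Removing the zero section from the trivial line bundle over `{a ≠ 0}`. -/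
lemma locClass_C_mul_X (a : A) :
    locClass K (C a * X) = (specClass K K[X] - 1) * locClass K a := by
  have hk : RingHom.ker ((aeval (0 : A)).restrictScalars K) = Ideal.span {(X : A[X])} := by
    have := Polynomial.ker_evalRingHom (0 : A)
    rw [C_0, sub_zero] at this
    rw [← this]
    ext p
    simp [RingHom.mem_ker, Polynomial.aeval_def, Polynomial.eval₂_eq_eval_map]
  have h := locClass_eq_add (K := K) ((aeval (0 : A)).restrictScalars K)
    (fun x => ⟨C x, by simp⟩) (C a) X hk
  rw [locClass_C, show (aeval (0 : A)).restrictScalars K (C a) = a by simp] at h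
  rw [sub_mul, h]
  ring

/-- The locus `b x + a = 0` in `{a ≠ 0, x ≠ 0}` is the graph of a function on `{a b ≠ 0}`. -/
lemma locClass_C_mul_X_eq_add (a b : A) :
    locClass K (C a * X) = locClass K (a * b) + locClass K (C a * X * (X * C b + C a)) := by
  set S := Localization.Away (C a * X)
  set B := Localization.Away (a * b)
  set g := algebraMap A[X] S (X * C b + C a) with hg
  have hab : algebraMap A B a * algebraMap A B b * IsLocalization.Away.invSelf (a * b) = 1 := by
    rw [← map_mul]; exact IsLocalization.Away.mul_invSelf _
  have hS : algebraMap A[X] S (C a) * algebraMap A[X] S X *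
      IsLocalization.Away.invSelf (C a * X) = 1 := by
    rw [← map_mul]; exact IsLocalization.Away.mul_invSelf _
  -- The witness is `β = -a / b`, written with the only available inverse `1 / (a b)`.
  obtain ⟨β, hβ⟩ : ∃ β : B, β * algebraMap A B b + algebraMap A B a = 0 :=
    ⟨-(algebraMap A B a ^ 2 * IsLocalization.Away.invSelf (a * b)), by
      linear_combination -(algebraMap A B a) * hab⟩
  have hau : IsUnit (algebraMap A B a) := IsUnit.of_mul_eq_one _ ((mul_assoc _ _ _).symm.trans hab)
  have hβu : IsUnit β := by
    have : IsUnit (β * algebraMap A B b) := by rw [eq_neg_of_add_eq_zero_left hβ]; exact hau.neg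
    exact isUnit_of_mul_isUnit_left this
  let φ₀ : A[X] →ₐ[K] B := (aeval β).restrictScalars K
  have hφC (x : A) : φ₀ (C x) = algebraMap A B x := by simp [φ₀]
  have hφX : φ₀ X = β := by simp [φ₀]
  have hu : IsUnit (φ₀ (C a * X)) := by rw [map_mul, hφC, hφX]; exact hau.mul hβu
  let φ : S →ₐ[K] B := IsLocalization.Away.liftAlgHom (C a * X) (f := φ₀) hu
  have hφ (p : A[X]) : φ (algebraMap A[X] S p) = φ₀ p :=
    IsLocalization.Away.lift_eq (g := (φ₀ : A[X] →+* B)) (C a * X) hu p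
  have hφS : algebraMap A B a * β * φ (IsLocalization.Away.invSelf (C a * X)) = 1 := by
    simpa only [map_mul, hφ, hφC, hφX, map_one] using congrArg φ hS
  have hφg : φ g = 0 := by
    rw [hg, hφ, map_add, map_mul, hφC, hφC, hφX, hβ]
  rw [← locClass_algebraMap (C a * X) (X * C b + C a)]
  refine specClass_eq_add φ (fun z => ?_) g (le_antisymm ?_ ?_)
  · obtain ⟨n, r, hr⟩ := IsLocalization.Away.surj (a * b) z
    -- The element `-X³ / (a X)²` is sent to `-β / a² = 1 / (a b)`, so its `n`-th power supplies the
    -- denominator of `z`.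
    refine ⟨algebraMap A[X] S (C r) *
      (algebraMap A[X] S (-X ^ 3) * IsLocalization.Away.invSelf (C a * X) ^ 2) ^ n, ?_⟩
    simp only [map_mul, map_pow, hφ, map_neg, hφC, hφX]
    rw [← hr, map_mul, mul_assoc, ← mul_pow]
    refine (congrArg (z * · ^ n) ?_).trans (by rw [one_pow, mul_one])
    generalize φ (IsLocalization.Away.invSelf (C a * X)) = v at *
    linear_combination (-β ^ 2 * v ^ 2 * algebraMap A B a) * hβ +
      (algebraMap A B a * β * v + 1) * hφS
  -- Modulo `g` one has `X b = -a` with `a` a unit, so `b` is a unit too. Hence `π` factors through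
  -- `φ`, by a map `ι : B → S / (g)`, and `ker φ ⊆ (g)`.
  · let π := Ideal.Quotient.mk (Ideal.span {g})
    let ι₀ : A →+* S ⧸ Ideal.span {g} := π.comp ((algebraMap A[X] S).comp C)
    have hπ : π (algebraMap A[X] S X) * ι₀ b + ι₀ a = 0 := by
      have h0 : π g = 0 := Ideal.Quotient.eq_zero_iff_mem.mpr (Ideal.mem_span_singleton_self g)
      have h1 : g = algebraMap A[X] S X * algebraMap A[X] S (C b) + algebraMap A[X] S (C a) := by
        rw [hg, map_add, map_mul]
      have h2 := congrArg π h1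
      rw [map_add, map_mul, h0] at h2
      exact h2.symm
    have ha : IsUnit (ι₀ a) := by
      refine IsUnit.of_mul_eq_one (π (algebraMap A[X] S X *
        IsLocalization.Away.invSelf (C a * X))) ?_
      have := congrArg π hS
      rwa [mul_assoc, map_mul, map_one] at this
    have hb : IsUnit (ι₀ b) := by
      have : IsUnit (π (algebraMap A[X] S X) * ι₀ b) := by
        rw [eq_neg_of_add_eq_zero_left hπ]; exact ha.neg
      exact isUnit_of_mul_isUnit_right this
    let ι : B →+* S ⧸ Ideal.span {g} := IsLocalization.Away.lift (a * b) (g := ι₀) (by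
      rw [map_mul]; exact ha.mul hb)
    have hι (x : A) : ι (algebraMap A B x) = ι₀ x := IsLocalization.Away.lift_eq _ _ _
    have hιφ : ι.comp (φ : S →+* B) = π := by
      refine IsLocalization.ringHom_ext (Submonoid.powers (C a * X)) (Polynomial.ringHom_ext
        (fun x => ?_) ?_)
      · change ι (φ (algebraMap A[X] S (C x))) = _
        rw [hφ, hφC, hι]; rfl
      · change ι (φ (algebraMap A[X] S X)) = π (algebraMap A[X] S X)
        rw [hφ, hφX]
        refine hb.mul_right_cancel ?_
        have := congrArg ι hβ
        rw [map_add, map_mul, hι, hι, map_zero] at this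
        linear_combination this - hπ
    intro x hx
    rw [← Ideal.Quotient.eq_zero_iff_mem]
    change π x = 0
    rw [← hιφ, RingHom.comp_apply, show (φ : S →+* B) x = 0 from hx, map_zero]
  · rw [Ideal.span_singleton_le_iff_mem]
    exact hφg

end localization

/-! ### The elementary symmetric polynomial of degree one less than the number of variables. -/

section almostProd

variable {R S : Type*} [CommSemiring R] [CommSemiring S]

/-- The elementary symmetric function of degree `n - 1` in `n` elements. -/
def almostProd {ι : Type*} [Fintype ι] [DecidableEq ι] (v : ι → R) : R :=
  ∑ i, ∏ j, if j = i then 1 else v j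

lemma map_almostProd {ι F : Type*} [Fintype ι] [DecidableEq ι] [FunLike F R S] [RingHomClass F R S]
    (φ : F) (v : ι → R) : φ (almostProd v) = almostProd fun i => φ (v i) := by
  simp only [almostProd, map_sum, map_prod]
  refine Finset.sum_congr rfl fun i _ => Finset.prod_congr rfl fun j _ => ?_
  split_ifs <;> simp

/-- Among the monomials, only the one omitting index `p` is free of `v p`. -/
lemma almostProd_succAbove {n : ℕ} (p : Fin (n + 1)) (v : Fin (n + 1) → R) :
    almostProd v =
      v p * almostProd (fun i => v (p.succAbove i)) + ∏ i, v (p.succAbove i) := by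
  rw [almostProd, Fin.sum_univ_succAbove _ p, add_comm, almostProd, Finset.mul_sum]
  congr 1
  · refine Finset.sum_congr rfl fun i _ => ?_
    rw [Fin.prod_univ_succAbove _ p, if_neg (Fin.succAbove_ne p i).symm]
    simp
  · rw [Fin.prod_univ_succAbove _ p, if_pos rfl, one_mul]
    exact Finset.prod_congr rfl fun j _ => if_neg (Fin.succAbove_ne p j)

lemma isHomogeneous_almostProd (R : Type*) [CommSemiring R] (n : ℕ) :
    (almostProd (MvPolynomial.X : Fin (n + 1) → MvPolynomial (Fin (n + 1)) R)).IsHomogeneous n := by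
  refine MvPolynomial.IsHomogeneous.sum _ _ _ fun i _ => ?_
  rw [Fin.prod_univ_succAbove _ i, if_pos rfl, one_mul]
  have := MvPolynomial.IsHomogeneous.prod (R := R) (Finset.univ : Finset (Fin n))
    (fun j => if i.succAbove j = i then 1 else MvPolynomial.X (i.succAbove j)) (fun _ => 1)
    (fun j _ => by
      rw [if_neg (Fin.succAbove_ne i j)]
      exact MvPolynomial.isHomogeneous_X _ _)
  simpa using this

end almostProd

/-! ### Tori and the dehomogenized polynomial in affine space. -/

section polynomialRings

variable {K : Type u} [Field K]

open MvPolynomial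

lemma specClass_mvPolynomial_of_isEmpty (σ : Type u) [IsEmpty σ] :
    specClass K (MvPolynomial σ K) = 1 := by
  rw [← specClass_field (K := K)]
  exact specClass_congr (isEmptyAlgEquiv K σ)

lemma classOf_affineSpace_zero : classOf (affineSpace K 0) = 1 := by
  rw [classOf_affineSpace, specClass_mvPolynomial_of_isEmpty]

lemma classOf_affineSpace_one :
    classOf (affineSpace K 1) = specClass K (Polynomial K) := by
  rw [classOf_affineSpace]
  exact specClass_congr (uniqueAlgEquiv K (ULift.{u} (Fin 1)))

lemma specClass_polynomial : specClass K (Polynomial K) = torusClass K + 1 := by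
  rw [torusClass, classOf_affineSpace_zero, classOf_affineSpace_one, sub_add_cancel]

lemma specClass_polynomial_sub_one : specClass K (Polynomial K) - 1 = torusClass K := by
  rw [specClass_polynomial, add_sub_cancel_right]

lemma specClass_mvPolynomial_fin (m : ℕ) :
    specClass K (MvPolynomial (Fin m) K) = (torusClass K + 1) ^ m := by
  induction m with
  | zero =>
    rw [pow_zero, ← specClass_field (K := K)]
    exact specClass_congr (isEmptyAlgEquiv K (Fin 0))
  | succ m ih =>
    rw [specClass_congr (finSuccEquiv K m), ← locClass_one, ← Polynomial.C_1, locClass_C,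
      locClass_one, ih, specClass_polynomial, pow_succ']

lemma specClass_mvPolynomial (σ : Type) [Fintype σ] :
    specClass K (MvPolynomial σ K) = (torusClass K + 1) ^ Fintype.card σ := by
  rw [← specClass_mvPolynomial_fin]
  exact specClass_congr (renameEquiv K (Fintype.equivFin σ))

lemma finSuccEquiv_prod_X (m : ℕ) :
    finSuccEquiv K m (∏ i, X i) = Polynomial.C (∏ i, X i) * Polynomial.X := by
  rw [Fin.prod_univ_succ, map_mul, map_prod, finSuccEquiv_X_zero, map_prod, mul_comm]
  simp only [finSuccEquiv_X_succ]

/-- The class of the torus of dimension `m`. -/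
lemma locClass_prod_X (m : ℕ) :
    locClass K (∏ i, X i : MvPolynomial (Fin m) K) = torusClass K ^ m := by
  induction m with
  | zero =>
    rw [Fin.prod_univ_zero, locClass_one, specClass_mvPolynomial_fin, pow_zero, pow_zero]
  | succ m ih =>
    rw [← locClass_map_equiv (finSuccEquiv K m), finSuccEquiv_prod_X, locClass_C_mul_X, ih,
      specClass_polynomial_sub_one, pow_succ']

variable (K) in
/-- The polynomial `almostProd` in `m + 1` variables, with one variable specialized to `1`. -/
def dehomogenized (m : ℕ) : MvPolynomial (Fin m) K :=
  almostProd X + ∏ i, X i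

/-- Affine-linearity in `x_0`, in the shape `b x + a` required by `locClass_C_mul_X_eq_add`; the
slope is the same polynomial in one variable fewer. -/
lemma finSuccEquiv_dehomogenized (m : ℕ) :
    finSuccEquiv K m (dehomogenized K (m + 1)) =
      Polynomial.X * Polynomial.C (dehomogenized K m) + Polynomial.C (∏ i, X i) := by
  rw [dehomogenized, dehomogenized, map_add, finSuccEquiv_prod_X, map_almostProd,
    almostProd_succAbove 0]
  simp only [Fin.zero_succAbove, finSuccEquiv_X_zero, finSuccEquiv_X_succ, map_add, map_prod,
    map_almostProd]
  ring

/-- The class of the complement of the hypersurface `dehomogenized = 0` in the torus. -/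
lemma locClass_prod_X_mul_dehomogenized (m : ℕ) :
    locClass K ((∏ i, X i) * dehomogenized K m) =
      ∑ k ∈ Finset.range (m + 1), (-1) ^ (m - k) * torusClass K ^ k := by
  induction m with
  | zero =>
    simp [dehomogenized, almostProd, locClass_one, specClass_mvPolynomial_fin]
  | succ m ih =>
    have h := locClass_C_mul_X_eq_add (K := K) (∏ i, X i) (dehomogenized K m)
    rw [← finSuccEquiv_dehomogenized, ← finSuccEquiv_prod_X, ← map_mul, locClass_map_equiv,
      locClass_map_equiv, locClass_prod_X, ih] at h
    have hs : ∑ k ∈ Finset.range (m + 1), (-1) ^ (m + 1 - k) * torusClass K ^ k =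
        -∑ k ∈ Finset.range (m + 1), (-1) ^ (m - k) * torusClass K ^ k := by
      rw [← Finset.sum_neg_distrib]
      refine Finset.sum_congr rfl fun k hk => ?_
      rw [Nat.succ_sub (Nat.lt_succ_iff.mp (Finset.mem_range.mp hk)), pow_succ]
      ring
    rw [Finset.sum_range_succ, hs, Nat.sub_self, pow_zero, one_mul, h]
    ring

/-- The coordinate hyperplane `x_p = 0` in affine space. -/
def coordinateSection (m : ℕ) (p : Fin (m + 1)) :
    MvPolynomial (Fin (m + 1)) K →ₐ[K] MvPolynomial (Fin m) K :=
  aeval (p.insertNth 0 X)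

lemma coordinateSection_X_self (m : ℕ) (p : Fin (m + 1)) :
    coordinateSection (K := K) m p (X p) = 0 := by
  simp [coordinateSection]

lemma coordinateSection_X_succAbove (m : ℕ) (p : Fin (m + 1)) (i : Fin m) :
    coordinateSection (K := K) m p (X (p.succAbove i)) = X i := by
  simp [coordinateSection]

lemma coordinateSection_surjective (m : ℕ) (p : Fin (m + 1)) :
    Function.Surjective (coordinateSection (K := K) m p) := by
  refine fun x => ⟨rename p.succAbove x, ?_⟩
  rw [coordinateSection, aeval_rename]
  simp [Function.comp_def]

lemma ker_coordinateSection (m : ℕ) (p : Fin (m + 1)) :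
    RingHom.ker (coordinateSection (K := K) m p) = Ideal.span {X p} := by
  refine le_antisymm (fun x hx => ?_) ?_
  -- Renaming along `p.succAbove` inverts the restriction modulo `X p`, so whatever the restriction
  -- kills vanishes modulo `X p`.
  · have h : ((Ideal.Quotient.mkₐ K (Ideal.span {(X p : MvPolynomial (Fin (m + 1)) K)})).comp
        (rename p.succAbove)).comp (coordinateSection m p) =
        Ideal.Quotient.mkₐ K (Ideal.span {(X p : MvPolynomial (Fin (m + 1)) K)}) := by
      refine MvPolynomial.algHom_ext fun i => ?_
      obtain rfl | ⟨i, rfl⟩ := p.eq_self_or_eq_succAbove i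
      · rw [AlgHom.comp_apply, coordinateSection_X_self, map_zero]
        exact (Ideal.Quotient.eq_zero_iff_mem.mpr (Ideal.mem_span_singleton_self _)).symm
      · rw [AlgHom.comp_apply, coordinateSection_X_succAbove, AlgHom.comp_apply, rename_X]
    rw [← Ideal.Quotient.eq_zero_iff_mem]
    change Ideal.Quotient.mkₐ K _ x = 0
    rw [← h, AlgHom.comp_apply, show coordinateSection m p x = 0 from hx, map_zero]
  · rw [Ideal.span_singleton_le_iff_mem]
    exact coordinateSection_X_self m p

lemma coordinateSection_dehomogenized (m : ℕ) (p : Fin (m + 1)) :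
    coordinateSection m p (dehomogenized K (m + 1)) = ∏ i, X i := by
  rw [dehomogenized, map_add, map_almostProd, almostProd_succAbove p, map_prod,
    Fin.prod_univ_succAbove _ p]
  simp [coordinateSection_X_self, coordinateSection_X_succAbove]

/-- Off the hypersurface at most one coordinate vanishes. The hyperplanes `x_p = 0` are removed one
at a time, and each removes a torus of dimension `m`. -/
lemma locClass_dehomogenized (m : ℕ) :
    locClass K (dehomogenized K (m + 1)) =
      locClass K ((∏ i, X i) * dehomogenized K (m + 1)) + (m + 1) * torusClass K ^ m := by
  have key (s : Finset (Fin (m + 1))) : locClass K (dehomogenized K (m + 1)) =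
      locClass K (dehomogenized K (m + 1) * ∏ i ∈ s, X i) + s.card * torusClass K ^ m := by
    induction s using Finset.induction_on with
    | empty => simp
    | insert p s hp ih =>
      rw [ih, locClass_eq_add (coordinateSection m p) (coordinateSection_surjective m p) _ (X p)
        (ker_coordinateSection m p), map_mul, coordinateSection_dehomogenized,
        locClass_mul_of_dvd_pow _ _ s.card, locClass_prod_X, Finset.card_insert_of_notMem hp,
        Finset.prod_insert hp]
      · push_cast
        rw [mul_comm (X p), mul_assoc]
        ring
      -- The coordinates removed earlier are already invertible on this stratum: each divides the
      -- product of all variables, so together they divide its `s.card`-th power.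
      · rw [map_prod, ← Finset.prod_const]
        refine Finset.prod_dvd_prod_of_dvd _ _ fun i hi => ?_
        obtain rfl | ⟨i, rfl⟩ := p.eq_self_or_eq_succAbove i
        · exact (hp hi).elim
        · rw [coordinateSection_X_succAbove]
          exact Finset.dvd_prod_of_mem _ (Finset.mem_univ i)
  have h := key Finset.univ
  rw [Finset.card_univ, Fintype.card_fin, mul_comm (dehomogenized _ _)] at h
  exact_mod_cast h

end polynomialRings

/-! ### Standard charts of projective space. -/

section charts

open MvPolynomial HomogeneousLocalization

variable {K : Type u} [Field K]

lemma aeval_mul_of_isHomogeneous {σ S : Type*} [CommRing S] [Algebra K S] {n : ℕ}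
    {p : MvPolynomial σ K} (hp : p.IsHomogeneous n) (c : S) (v : σ → S) :
    aeval (fun i => c * v i) p = c ^ n * aeval v p := by
  rw [aeval_def, aeval_def, eval₂_eq, eval₂_eq, Finset.mul_sum]
  refine Finset.sum_congr rfl fun d hd => ?_
  simp_rw [mul_pow]
  rw [Finset.prod_mul_distrib, Finset.prod_pow_eq_pow_sum, hp.degree_eq_sum_deg_support hd]
  ring

/-- Specialization of the homogeneous coordinate `t_j` to `1`. -/
def dehomogenize {m : ℕ} (j : Fin (m + 1)) :
    MvPolynomial (Fin (m + 1)) K →ₐ[K] MvPolynomial (Fin m) K :=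
  aeval (j.insertNth 1 X)

lemma dehomogenize_X_self {m : ℕ} (j : Fin (m + 1)) : dehomogenize (K := K) j (X j) = 1 := by
  simp [dehomogenize]

lemma dehomogenize_X_succAbove {m : ℕ} (j : Fin (m + 1)) (i : Fin m) :
    dehomogenize (K := K) j (X (j.succAbove i)) = X i := by
  simp [dehomogenize]

lemma isUnit_dehomogenize {m : ℕ} (j : Fin (m + 1)) :
    IsUnit ((dehomogenize (K := K) j : MvPolynomial (Fin (m + 1)) K →+* MvPolynomial (Fin m) K) (X j)) := by
  rw [RingHom.coe_coe, dehomogenize_X_self]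
  exact isUnit_one

lemma X_mem_grading {m : ℕ} (j : Fin m) : (X j : MvPolynomial (Fin m) K) ∈ grading K m 1 :=
  isHomogeneous_X K j

/-- The homogeneous localization at a coordinate maps to the polynomial ring in the other
coordinates. -/
def awayHom {m : ℕ} (j : Fin (m + 1)) :
    Away (grading K (m + 1)) (X j) →+* MvPolynomial (Fin m) K :=
  (IsLocalization.Away.lift (S := Localization.Away (X j : MvPolynomial (Fin (m + 1)) K)) (X j)
    (isUnit_dehomogenize j)).comp (algebraMap _ _)

lemma awayHom_mk {m : ℕ} (j : Fin (m + 1)) (n : ℕ) (x : MvPolynomial (Fin (m + 1)) K)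
    (hx : x ∈ grading K (m + 1) (n • 1)) :
    awayHom j (Away.mk _ (X_mem_grading j) n x hx) = dehomogenize j x := by
  have h : algebraMap (Away (grading K (m + 1)) (X j))
      (Localization.Away (X j : MvPolynomial (Fin (m + 1)) K))
      (Away.mk _ (X_mem_grading j) n x hx) * algebraMap (MvPolynomial (Fin (m + 1)) K) _ (X j) ^ n =
        algebraMap (MvPolynomial (Fin (m + 1)) K) _ x := by
    rw [HomogeneousLocalization.algebraMap_apply, Away.val_mk, ← map_pow, Localization.mk_eq_mk']
    exact IsLocalization.mk'_spec _ _ _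
  have h' := congrArg (IsLocalization.Away.lift
    (S := Localization.Away (X j : MvPolynomial (Fin (m + 1)) K)) (X j)
    (isUnit_dehomogenize (K := K) j)) h
  rw [map_mul, map_pow, IsLocalization.Away.lift_eq, IsLocalization.Away.lift_eq, RingHom.coe_coe,
    dehomogenize_X_self, one_pow, mul_one] at h'
  exact h'

lemma awayHom_surjective {m : ℕ} (j : Fin (m + 1)) :
    Function.Surjective (awayHom (K := K) j) := by
  have hC (c : K) : ∃ z, awayHom j z = C c := by
    refine ⟨Away.mk _ (X_mem_grading j) 0 (C c) ?_, ?_⟩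
    · simp
    · rw [awayHom_mk]
      exact (dehomogenize j).commutes c
  intro x
  change x ∈ (awayHom (K := K) j).range
  induction x using MvPolynomial.induction_on with
  | C c => exact hC c
  | add p q hp hq => exact add_mem hp hq
  | mul_X p i hp =>
    refine mul_mem hp ⟨Away.mk _ (X_mem_grading j) 1 (X (j.succAbove i)) ?_, ?_⟩
    · simpa using isHomogeneous_X K (j.succAbove i)
    · rw [awayHom_mk, dehomogenize_X_succAbove]

lemma awayHom_injective {m : ℕ} (j : Fin (m + 1)) :
    Function.Injective (awayHom (K := K) j) := by
  rw [injective_iff_map_eq_zero]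
  intro z hz
  obtain ⟨n, x, hx, rfl⟩ := Away.mk_surjective (grading K (m + 1)) (X_mem_grading j) z
  rw [awayHom_mk] at hz
  set S := Localization.Away (X j : MvPolynomial (Fin (m + 1)) K)
  set s : S := IsLocalization.Away.invSelf (X j : MvPolynomial (Fin (m + 1)) K)
  have hs : algebraMap (MvPolynomial (Fin (m + 1)) K) S (X j) * s = 1 :=
    IsLocalization.Away.mul_invSelf (S := S) (X j : MvPolynomial (Fin (m + 1)) K)
  -- With `s = 1 / X_j`, homogeneity gives `x = X_j ^ n · x(X_i / X_j)` in the localization, and the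
  -- second factor depends only on `dehomogenize j x`.
  have h₁ : (IsScalarTower.toAlgHom K (MvPolynomial (Fin (m + 1)) K) S) =
      aeval fun i => algebraMap (MvPolynomial (Fin (m + 1)) K) S (X j) *
        (s * algebraMap (MvPolynomial (Fin (m + 1)) K) S (X i)) := by
    refine MvPolynomial.algHom_ext fun i => ?_
    rw [aeval_X, ← mul_assoc, hs, one_mul]
    rfl
  have h₂ : (aeval fun i => s * algebraMap (MvPolynomial (Fin (m + 1)) K) S (X i)) =
      (aeval fun i => s * algebraMap (MvPolynomial (Fin (m + 1)) K) S (X (j.succAbove i))).comp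
        (dehomogenize (K := K) j) := by
    refine MvPolynomial.algHom_ext fun i => ?_
    obtain rfl | ⟨i, rfl⟩ := j.eq_self_or_eq_succAbove i
    · rw [AlgHom.comp_apply, dehomogenize_X_self, aeval_X, map_one, mul_comm, hs]
    · rw [AlgHom.comp_apply, dehomogenize_X_succAbove, aeval_X, aeval_X]
  have hx0 : algebraMap (MvPolynomial (Fin (m + 1)) K) S x = 0 := by
    have := congrArg (fun φ : _ →ₐ[K] S => φ x) h₁
    rw [aeval_mul_of_isHomogeneous hx, h₂, AlgHom.comp_apply, hz, map_zero, mul_zero] at this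
    exact this
  rw [HomogeneousLocalization.ext_iff_val, Away.val_mk, val_zero, Localization.mk_eq_mk',
    IsLocalization.mk'_eq_zero_iff]
  obtain ⟨c, hc⟩ := (IsLocalization.map_eq_zero_iff (Submonoid.powers
    (X j : MvPolynomial (Fin (m + 1)) K)) S x).mp hx0
  exact ⟨c, hc⟩

variable (K) in
/-- The standard chart `𝔸^m → ℙ^m` with image `{t_j ≠ 0}`. -/
def chart {m : ℕ} (j : Fin (m + 1)) :
    Spec (CommRingCat.of (MvPolynomial (Fin m) K)) ⟶ projScheme K (m + 1) :=
  Spec.map (CommRingCat.ofHom (awayHom j)) ≫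
    Proj.awayι (grading K (m + 1)) (X j) (X_mem_grading j) one_pos

instance {m : ℕ} (j : Fin (m + 1)) : IsIso (CommRingCat.ofHom (awayHom (K := K) j)) :=
  (RingEquiv.ofBijective (awayHom (K := K) j)
    ⟨awayHom_injective j, awayHom_surjective j⟩).toCommRingCatIso.isIso_hom

instance {m : ℕ} (j : Fin (m + 1)) : IsOpenImmersion (chart K j) := by
  unfold chart; infer_instance

lemma chart_structure {m : ℕ} (j : Fin (m + 1)) :
    chart K j ≫ projStructure K (m + 1) =
      Spec.map (CommRingCat.ofHom (algebraMap K (MvPolynomial (Fin m) K))) := by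
  rw [chart, projStructure, Category.assoc, Proj.awayι_toSpecZero_assoc, ← Spec.map_comp,
    ← Spec.map_comp, ← CommRingCat.ofHom_comp, ← CommRingCat.ofHom_comp]
  refine congrArg (fun φ => Spec.map (CommRingCat.ofHom φ)) (RingHom.ext fun c => ?_)
  have h : fromZeroRingHom (grading K (m + 1)) (Submonoid.powers (X j)) (algebraMap K _ c) =
      Away.mk _ (X_mem_grading j) 0 (C c) (by simp) := by
    ext
    rw [Away.val_mk]
    exact congrArg (Localization.mk (C c)) (Subtype.ext (pow_zero (X j)).symm)
  change awayHom j (fromZeroRingHom (grading K (m + 1)) (Submonoid.powers (X j)) _) = _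
  rw [h, awayHom_mk]
  exact (dehomogenize j).commutes c

lemma chart_preimage_basicOpen {m : ℕ} (j : Fin (m + 1)) {d : ℕ} (hd : 0 < d)
    {f : MvPolynomial (Fin (m + 1)) K} (hf : f.IsHomogeneous d) :
    chart K j ⁻¹ᵁ Proj.basicOpen (grading K (m + 1)) f =
      PrimeSpectrum.basicOpen (dehomogenize j f) := by
  rw [chart, Scheme.Hom.comp_preimage, Proj.awayι_preimage_basicOpen _ _ _ (g_deg := hf) (hm' := hd)]
  ext x
  -- The basic open set is cut out on the chart by `f ^ deg X_j / X_j ^ d`, whence the exponent `1`.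
  change awayHom j (Away.mk _ (X_mem_grading j) d (f ^ 1) _) ∉ x.asIdeal ↔
    dehomogenize j f ∉ x.asIdeal
  rw [awayHom_mk, pow_one]

lemma chart_mem_basicOpen_iff {m : ℕ} (j : Fin (m + 1)) {d : ℕ} (hd : 0 < d)
    {f : MvPolynomial (Fin (m + 1)) K} (hf : f.IsHomogeneous d)
    (x : PrimeSpectrum (MvPolynomial (Fin m) K)) :
    chart K j x ∈ Proj.basicOpen (grading K (m + 1)) f ↔ dehomogenize j f ∉ x.asIdeal := by
  change x ∈ chart K j ⁻¹ᵁ Proj.basicOpen (grading K (m + 1)) f ↔ _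
  rw [chart_preimage_basicOpen j hd hf]
  rfl

lemma range_chart {m : ℕ} (j : Fin (m + 1)) :
    Set.range (chart K j) = Proj.basicOpen (grading K (m + 1)) (X j) := by
  have h : (chart K j).opensRange = Proj.basicOpen (grading K (m + 1)) (X j) := by
    refine (Scheme.Hom.opensRange_comp_of_isIso _ _).trans ?_
    exact Proj.opensRange_awayι _ _ _ _
  exact congrArg (fun U : (projScheme K (m + 1)).Opens => (U : Set (projScheme K (m + 1)))) h

end charts

section strata

open MvPolynomial

variable {K : Type u} [Field K]

lemma isImmersion_of_isOpenImmersion {X Y : Scheme.{u}} {f : X ⟶ Y} (hf : IsOpenImmersion f) :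
    IsImmersion f := inferInstance

/-- If `V ∖ U` is the image of an affine variety immersed in a chart of projective space, then
`[V] = [U] + [V ∖ U]`. -/
lemma classOf_openSubvariety_eq_add_specClass {m : ℕ} (j : Fin (m + 1))
    {U V : (projScheme K (m + 1)).Opens} (hUV : U ≤ V)
    {B : Type u} [CommRing B] [Algebra K B] [Algebra.FiniteType K B]
    (φ : MvPolynomial (Fin m) K →ₐ[K] B) (hφ : IsImmersion (specHom φ).left)
    (s : Set (PrimeSpectrum (MvPolynomial (Fin m) K)))
    (hs : Set.range (PrimeSpectrum.comap (φ : MvPolynomial (Fin m) K →+* B)) = s)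
    (h : chart K j '' s = (V : Set (projScheme K (m + 1))) \ U) :
    classOf (openSubvariety K (m + 1) V) =
      classOf (openSubvariety K (m + 1) U) + specClass K B := by
  let g : (specVar K B).obj.left ⟶ projScheme K (m + 1) := (specHom φ).left ≫ chart K j
  have hc : IsOpenImmersion (chart K j) := inferInstance
  have hg : IsImmersion g :=
    @IsImmersion.comp _ _ _ (specHom φ).left (chart K j) hφ (isImmersion_of_isOpenImmersion hc)
  refine classOf_openSubvariety_eq_add hUV (specVar K B) g ?_ ?_
  · exact (Category.assoc _ _ _).trans
      ((congrArg ((specHom φ).left ≫ ·) (chart_structure j)).trans (Over.w (specHom φ)))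
  · rw [← h, ← hs]
    exact Set.range_comp (chart K j) (specHom φ).left

lemma specHom_isImmersion_of_surjective {A B : Type u} [CommRing A] [CommRing B] [Algebra K A]
    [Algebra K B] [Algebra.FiniteType K A] [Algebra.FiniteType K B] (φ : A →ₐ[K] B)
    (hφ : Function.Surjective φ) : IsImmersion (specHom φ).left :=
  have : IsClosedImmersion (specHom φ).left :=
    IsClosedImmersion.spec_of_surjective (CommRingCat.ofHom (φ : A →+* B)) hφ
  inferInstance

lemma specHom_isOpenImmersion {A : Type u} [CommRing A] [Algebra K A] [Algebra.FiniteType K A]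
    (f : A) : IsOpenImmersion (specHom (IsScalarTower.toAlgHom K A (Localization.Away f))).left :=
  inferInstanceAs (IsOpenImmersion
      (Spec.map (CommRingCat.ofHom (algebraMap A (Localization.Away f)))))

lemma range_comap_toAlgHom {A : Type u} [CommRing A] [Algebra K A] (f : A) :
    Set.range (PrimeSpectrum.comap
      (IsScalarTower.toAlgHom K A (Localization.Away f) : A →+* Localization.Away f)) =
      {x | f ∉ x.asIdeal} :=
  PrimeSpectrum.localization_away_comap_range (Localization.Away f) f

lemma exists_chart_eq {m : ℕ} (j : Fin (m + 1)) {y : projScheme K (m + 1)}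
    (hy : y ∈ Proj.basicOpen (grading K (m + 1)) (X j)) : ∃ x, chart K j x = y := by
  rw [← SetLike.mem_coe, ← range_chart] at hy
  exact hy

lemma chart_mem_basicOpen_X_iff {m : ℕ} (j i : Fin (m + 1))
    (x : PrimeSpectrum (MvPolynomial (Fin m) K)) :
    chart K j x ∈ Proj.basicOpen (grading K (m + 1)) (X i) ↔
      dehomogenize j (X i) ∉ x.asIdeal :=
  chart_mem_basicOpen_iff j one_pos (isHomogeneous_X K i) x

lemma chart_mem_basicOpen_X_self {m : ℕ} (j : Fin (m + 1))
    (x : PrimeSpectrum (MvPolynomial (Fin m) K)) :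
    chart K j x ∈ Proj.basicOpen (grading K (m + 1)) (X j) := by
  refine (chart_mem_basicOpen_X_iff j j x).mpr ?_
  rw [dehomogenize_X_self]
  exact x.2.one_notMem

lemma chart_mem_basicOpen_X_succAbove_iff {m : ℕ} (j : Fin (m + 1)) (i : Fin m)
    (x : PrimeSpectrum (MvPolynomial (Fin m) K)) :
    chart K j x ∈ Proj.basicOpen (grading K (m + 1)) (X (j.succAbove i)) ↔ X i ∉ x.asIdeal := by
  refine (chart_mem_basicOpen_X_iff j _ x).trans ?_
  rw [dehomogenize_X_succAbove]

/-! ### The class of projective space. -/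

section projectiveSpace

lemma ker_killCompl {σ τ : Type*} {f : σ → τ} (hf : Function.Injective f) :
    RingHom.ker (killCompl (R := K) hf) = Ideal.span (X '' (Set.range f)ᶜ) := by
  refine le_antisymm (fun x hx => ?_) ?_
  · set I : Ideal (MvPolynomial τ K) := Ideal.span (X '' (Set.range f)ᶜ)
    have h : ((Ideal.Quotient.mkₐ K I).comp (rename f)).comp (killCompl hf) =
        Ideal.Quotient.mkₐ K I := by
      refine MvPolynomial.algHom_ext fun i => ?_
      by_cases hi : i ∈ Set.range f
      · obtain ⟨i, rfl⟩ := hi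
        rw [AlgHom.comp_apply, ← rename_X, killCompl_rename_app, AlgHom.comp_apply]
      · rw [AlgHom.comp_apply, killCompl, aeval_X, dif_neg hi, map_zero]
        have hI : (X i : MvPolynomial τ K) ∈ I := Ideal.subset_span ⟨i, hi, rfl⟩
        exact (Ideal.Quotient.eq_zero_iff_mem.mpr hI).symm
    rw [← Ideal.Quotient.eq_zero_iff_mem]
    change Ideal.Quotient.mkₐ K _ x = 0
    rw [← h, AlgHom.comp_apply, show killCompl hf x = 0 from hx, map_zero]
  · rw [Ideal.span_le]
    rintro _ ⟨i, hi, rfl⟩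
    change killCompl hf (X i) = 0
    rw [killCompl, aeval_X, dif_neg hi]

variable (K) in
/-- The union of the first `n` standard charts of projective space. -/
def chartUnion (m n : ℕ) : (projScheme K (m + 1)).Opens :=
  ⨆ i : {i : Fin (m + 1) // i.val < n}, Proj.basicOpen (grading K (m + 1)) (X i.1)

lemma mem_chartUnion {m n : ℕ} {y : projScheme K (m + 1)} :
    y ∈ chartUnion K m n ↔
      ∃ i : Fin (m + 1), i.val < n ∧ y ∈ Proj.basicOpen (grading K (m + 1)) (X i) := by
  rw [chartUnion, TopologicalSpace.Opens.mem_iSup]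
  constructor
  · rintro ⟨i, hi⟩
    exact ⟨i.1, i.2, hi⟩
  · rintro ⟨i, hi, h⟩
    exact ⟨⟨i, hi⟩, h⟩

lemma chartUnion_zero (m : ℕ) : chartUnion K m 0 = ⊥ := by
  refine eq_bot_iff.mpr fun y hy => ?_
  obtain ⟨i, hi, -⟩ := mem_chartUnion.mp hy
  exact absurd hi (Nat.not_lt_zero _)

lemma chartUnion_top (m : ℕ) : chartUnion K m (m + 1) = ⊤ := by
  have h : ⨆ i : Fin (m + 1), Proj.basicOpen (grading K (m + 1)) (X i) = ⊤ := by
    refine Proj.iSup_basicOpen_eq_top' _ _ (fun i => ⟨1, X_mem_grading i⟩) ?_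
    refine top_le_iff.mp fun x _ => ?_
    induction x using MvPolynomial.induction_on with
    | C c =>
      exact Subalgebra.algebraMap_mem _ (⟨C c, isHomogeneous_C _ c⟩ : grading K (m + 1) 0)
    | add p q hp hq => exact add_mem (hp trivial) (hq trivial)
    | mul_X p i hp => exact mul_mem (hp trivial) (Algebra.subset_adjoin ⟨i, rfl⟩)
  refine eq_top_iff.mpr fun y _ => ?_
  have hy : y ∈ ⨆ i : Fin (m + 1), Proj.basicOpen (grading K (m + 1)) (X i) := by
    rw [h]; trivial
  obtain ⟨i, hi⟩ := TopologicalSpace.Opens.mem_iSup.mp hy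
  exact mem_chartUnion.mpr ⟨i, i.2, hi⟩

/-- The points gained from chart `n` are those with `t_n ≠ 0` and all earlier coordinates zero: a
linear subspace of dimension `m - n` in that chart, embedded through `killCompl`. -/
lemma classOf_chartUnion_succ {m n : ℕ} (hn : n ≤ m) :
    classOf (openSubvariety K (m + 1) (chartUnion K m (n + 1))) =
      classOf (openSubvariety K (m + 1) (chartUnion K m n)) + (torusClass K + 1) ^ (m - n) := by
  let j : Fin (m + 1) := ⟨n, Nat.lt_succ_iff.mpr hn⟩
  have hcard : Fintype.card {i : Fin m // ¬ i.val < n} = m - n := by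
    rw [Fintype.card_subtype_compl, Fintype.card_fin, Fintype.card_subtype]
    rw [Fin.card_filter_val_lt, min_eq_right hn]
  have hinj : Function.Injective (Subtype.val : {i : Fin m // ¬ i.val < n} → Fin m) :=
    Subtype.val_injective
  have hsurj : Function.Surjective (killCompl (R := K) hinj) :=
    fun p => ⟨rename _ p, killCompl_rename_app hinj p⟩
  rw [← hcard, ← specClass_mvPolynomial]
  refine classOf_openSubvariety_eq_add_specClass j (fun y hy => ?_)
    (killCompl (R := K) hinj) (specHom_isImmersion_of_surjective _ hsurj)
    {x | ∀ i : Fin m, i.val < n → X i ∈ x.asIdeal} ?_ ?_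
  · obtain ⟨i, hi, h⟩ := mem_chartUnion.mp hy
    exact mem_chartUnion.mpr ⟨i, hi.trans (Nat.lt_succ_self n), h⟩
  · refine (range_comap_of_surjective _ (killCompl (R := K) hinj : MvPolynomial (Fin m) K →+*
      MvPolynomial {i : Fin m // ¬ i.val < n} K) hsurj).trans ?_
    refine (congrArg (fun I : Ideal (MvPolynomial (Fin m) K) =>
      PrimeSpectrum.zeroLocus (I : Set (MvPolynomial (Fin m) K)))
      (ker_killCompl hinj)).trans ?_
    rw [PrimeSpectrum.zeroLocus_span]
    ext x
    simp [PrimeSpectrum.mem_zeroLocus, Set.subset_def]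
  · have hsucc (i : Fin m) (hi : i.val < n) : j.succAbove i = i.castSucc :=
      Fin.succAbove_of_castSucc_lt j i hi
    ext y
    constructor
    · rintro ⟨x, hx, rfl⟩
      refine ⟨mem_chartUnion.mpr ⟨j, Nat.lt_succ_self n, chart_mem_basicOpen_X_self j x⟩,
        fun hy => ?_⟩
      obtain ⟨i, hi, h⟩ := mem_chartUnion.mp hy
      rw [show i = j.succAbove ⟨i, hi.trans_le hn⟩ from (hsucc ⟨i, hi.trans_le hn⟩ hi).symm] at h
      exact (chart_mem_basicOpen_X_succAbove_iff j _ x).mp h (hx _ hi)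
    · rintro ⟨hy, hy'⟩
      have hy'' (i : Fin (m + 1)) (hi : i.val < n) :
          y ∉ Proj.basicOpen (grading K (m + 1)) (X i) :=
        fun h => hy' (mem_chartUnion.mpr ⟨i, hi, h⟩)
      obtain ⟨i, hi, h⟩ := mem_chartUnion.mp hy
      obtain rfl : i = j :=
        Fin.ext (le_antisymm (Nat.lt_succ_iff.mp hi) (not_lt.mp fun hlt => hy'' i hlt h))
      obtain ⟨x, rfl⟩ := exists_chart_eq _ h
      refine ⟨x, fun i hi => ?_, rfl⟩
      have := hy'' i.castSucc hi
      rw [← hsucc i hi] at this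
      exact not_not.mp fun h => this ((chart_mem_basicOpen_X_succAbove_iff j i x).mpr h)

/-- The class of projective space. -/
lemma classOf_projectiveSpace (m : ℕ) :
    classOf (projectiveSpace K m) = ∑ i ∈ Finset.range (m + 1), (torusClass K + 1) ^ i := by
  have h (n : ℕ) (hn : n ≤ m + 1) : classOf (openSubvariety K (m + 1) (chartUnion K m n)) =
      ∑ i ∈ Finset.range n, (torusClass K + 1) ^ (m - i) := by
    induction n with
    | zero => rw [chartUnion_zero, classOf_openSubvariety_bot, Finset.sum_range_zero]
    | succ n ih =>
      rw [classOf_chartUnion_succ (Nat.lt_succ_iff.mp hn), ih (by omega), Finset.sum_range_succ]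
  rw [← classOf_openSubvariety_top, ← chartUnion_top, h _ le_rfl,
    ← Finset.sum_range_reflect]
  exact Finset.sum_congr rfl fun i hi => by
    rw [Finset.mem_range] at hi
    congr 1
    omega

end projectiveSpace

end strata

/-! ### The complement of the symmetric hypersurface in projective space. -/

section almostProdComplement

open MvPolynomial

variable {K : Type u} [Field K]

lemma specHom_comp {A B C : Type u} [CommRing A] [CommRing B] [CommRing C] [Algebra K A]
    [Algebra K B] [Algebra K C] [Algebra.FiniteType K A] [Algebra.FiniteType K B]
    [Algebra.FiniteType K C] (φ : A →ₐ[K] B) (ψ : B →ₐ[K] C) :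
    specHom (ψ.comp φ) = specHom ψ ≫ specHom φ := by
  ext1
  exact Spec.map_comp (CommRingCat.ofHom (φ : A →+* B)) (CommRingCat.ofHom (ψ : B →+* C))

lemma dehomogenize_almostProd {m : ℕ} (j : Fin (m + 1)) :
    dehomogenize j (almostProd X) = dehomogenized K m := by
  rw [map_almostProd, almostProd_succAbove j, dehomogenized]
  simp only [dehomogenize_X_self, dehomogenize_X_succAbove, one_mul]

lemma dehomogenized_succ (m : ℕ) :
    dehomogenized K (m + 1) = X 0 * (almostProd (fun i : Fin m => X i.succ) + ∏ i : Fin m, X i.succ)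
      + ∏ i : Fin m, X i.succ := by
  rw [dehomogenized, almostProd_succAbove 0, Fin.prod_univ_succ]
  simp only [Fin.zero_succAbove]
  ring

variable (K) in
/-- The complement of the hypersurface `almostProd = 0` in projective space. -/
def almostProdOpen (m : ℕ) : (projScheme K (m + 2)).Opens :=
  Proj.basicOpen (grading K (m + 2)) (almostProd X)

lemma chart_mem_almostProdOpen_iff {m : ℕ} (j : Fin (m + 2))
    (x : PrimeSpectrum (MvPolynomial (Fin (m + 1)) K)) :
    chart K j x ∈ almostProdOpen K m ↔ dehomogenized K (m + 1) ∉ x.asIdeal := by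
  refine (chart_mem_basicOpen_iff j (Nat.succ_pos m) (isHomogeneous_almostProd K (m + 1)) x).trans ?_
  rw [dehomogenize_almostProd]

lemma classOf_almostProdOpen_inf (m : ℕ) :
    classOf (openSubvariety K (m + 2)
        (almostProdOpen K m ⊓ Proj.basicOpen (grading K (m + 2)) (X 0))) =
      locClass K (dehomogenized K (m + 1)) := by
  rw [← zero_add (locClass K _), ← classOf_openSubvariety_bot (K := K) (m + 2)]
  refine classOf_openSubvariety_eq_add_specClass 0 bot_le (IsScalarTower.toAlgHom K _ _)
    (isImmersion_of_isOpenImmersion (specHom_isOpenImmersion _)) _ (range_comap_toAlgHom _) ?_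
  ext y
  constructor
  · rintro ⟨x, hx, rfl⟩
    exact ⟨⟨(chart_mem_almostProdOpen_iff 0 x).mpr hx, chart_mem_basicOpen_X_self 0 x⟩, id⟩
  · rintro ⟨⟨hy, hy'⟩, -⟩
    obtain ⟨x, rfl⟩ := exists_chart_eq 0 hy'
    exact ⟨x, (chart_mem_almostProdOpen_iff 0 x).mp hy, rfl⟩

lemma range_comap_torusSection (m : ℕ) :
    Set.range (PrimeSpectrum.comap (((IsScalarTower.toAlgHom K (MvPolynomial (Fin m) K)
      (Localization.Away (∏ i, X i : MvPolynomial (Fin m) K))).comp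
        (coordinateSection (K := K) m 0)) : MvPolynomial (Fin (m + 1)) K →+*
          Localization.Away (∏ i, X i : MvPolynomial (Fin m) K))) =
      {x | X 0 ∈ x.asIdeal ∧ ∏ i : Fin m, X i.succ ∉ x.asIdeal} := by
  have h : Set.range (PrimeSpectrum.comap
      (coordinateSection (K := K) m 0 : MvPolynomial (Fin (m + 1)) K →+* MvPolynomial (Fin m) K)) =
      {x | X 0 ∈ x.asIdeal} := by
    refine (range_comap_of_surjective _ (coordinateSection (K := K) m 0 :
      MvPolynomial (Fin (m + 1)) K →+* MvPolynomial (Fin m) K)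
      (coordinateSection_surjective m 0)).trans ?_
    refine (congrArg (fun I : Ideal (MvPolynomial (Fin (m + 1)) K) =>
      PrimeSpectrum.zeroLocus (I : Set (MvPolynomial (Fin (m + 1)) K)))
      (ker_coordinateSection m 0)).trans ?_
    rw [PrimeSpectrum.zeroLocus_span]
    ext x
    simp [PrimeSpectrum.mem_zeroLocus]
  have hprod : coordinateSection (K := K) m 0 (∏ i : Fin m, X i.succ) = ∏ i, X i := by
    rw [map_prod]
    exact Finset.prod_congr rfl fun i _ => coordinateSection_X_succAbove m 0 i
  have hcomp := Set.range_comp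
    (PrimeSpectrum.comap
      (coordinateSection (K := K) m 0 : MvPolynomial (Fin (m + 1)) K →+* MvPolynomial (Fin m) K))
    (PrimeSpectrum.comap (IsScalarTower.toAlgHom K (MvPolynomial (Fin m) K)
      (Localization.Away (∏ i, X i : MvPolynomial (Fin m) K)) :
        MvPolynomial (Fin m) K →+* Localization.Away (∏ i, X i : MvPolynomial (Fin m) K)))
  rw [range_comap_toAlgHom] at hcomp
  refine Eq.trans hcomp ?_
  ext x
  constructor
  · rintro ⟨z, hz, rfl⟩
    refine ⟨(Set.ext_iff.mp h _).mp ⟨z, rfl⟩, fun hx => hz ?_⟩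
    rw [← hprod]
    exact hx
  · rintro ⟨hx₁, hx₂⟩
    obtain ⟨z, rfl⟩ := (Set.ext_iff.mp h x).mpr hx₁
    refine ⟨z, fun hz => hx₂ ?_, rfl⟩
    rw [← hprod] at hz
    exact hz

/-- Every monomial omits a single variable, so it contains `X 0` or `X 1`. Hence the points of the
complement at infinity (`t_0 = 0`) all lie in chart `1`. -/
lemma almostProd_mem_of_mem {m : ℕ} (I : Ideal (MvPolynomial (Fin (m + 2)) K)) (h₀ : X 0 ∈ I)
    (h₁ : X 1 ∈ I) : almostProd X ∈ I := by
  rw [almostProd_succAbove 0, Fin.prod_univ_succ]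
  exact add_mem (Ideal.mul_mem_right _ _ h₀) (Ideal.mul_mem_right _ _ h₁)

/-- Chart `0` gives the first term. On `t_0 = 0`, seen in chart `1`, the equation reduces to the
product of the other coordinates, and its nonvanishing locus is a torus of dimension `m`. -/
lemma classOf_almostProdOpen (m : ℕ) :
    classOf (openSubvariety K (m + 2) (almostProdOpen K m)) =
      locClass K (dehomogenized K (m + 1)) + torusClass K ^ m := by
  rw [← classOf_almostProdOpen_inf, ← locClass_prod_X]
  have h01 : (1 : Fin (m + 2)).succAbove (0 : Fin (m + 1)) = 0 := rfl
  have hmem (x : PrimeSpectrum (MvPolynomial (Fin (m + 1)) K)) (hx : X 0 ∈ x.asIdeal) :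
      dehomogenized K (m + 1) ∈ x.asIdeal ↔ ∏ i : Fin m, X i.succ ∈ x.asIdeal := by
    rw [dehomogenized_succ]
    exact Ideal.add_mem_iff_right _ (Ideal.mul_mem_right _ _ hx)
  refine classOf_openSubvariety_eq_add_specClass 1 inf_le_left
    ((IsScalarTower.toAlgHom K (MvPolynomial (Fin m) K)
      (Localization.Away (∏ i, X i : MvPolynomial (Fin m) K))).comp
        (coordinateSection (K := K) m 0)) ?_ _ (range_comap_torusSection m) ?_
  · rw [specHom_comp, Over.comp_left]
    have h₁ := isImmersion_of_isOpenImmersion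
      (specHom_isOpenImmersion (K := K) (∏ i, X i : MvPolynomial (Fin m) K))
    have h₂ := specHom_isImmersion_of_surjective _ (coordinateSection_surjective (K := K) m 0)
    exact IsImmersion.comp _ _
  · ext y
    constructor
    · rintro ⟨x, ⟨hx₁, hx₂⟩, rfl⟩
      refine ⟨(chart_mem_almostProdOpen_iff 1 x).mpr (mt (hmem x hx₁).mp hx₂), fun hy => ?_⟩
      have := hy.2
      rw [← h01] at this
      exact (chart_mem_basicOpen_X_succAbove_iff 1 0 x).mp this hx₁
    · rintro ⟨hy, hy'⟩
      have hy₀ : X 0 ∈ y.asHomogeneousIdeal := by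
        by_contra h
        exact hy' ⟨hy, h⟩
      have hy₁ : y ∈ Proj.basicOpen (grading K (m + 2)) (X 1) := by
        intro h
        exact hy (almostProd_mem_of_mem y.asHomogeneousIdeal.toIdeal hy₀ h)
      obtain ⟨x, rfl⟩ := exists_chart_eq 1 hy₁
      have hx₁ : X 0 ∈ x.asIdeal := by
        by_contra h
        have := (chart_mem_basicOpen_X_succAbove_iff 1 0 x).mpr h
        rw [h01] at this
        exact this hy₀
      exact ⟨x, ⟨hx₁, mt (hmem x hx₁).mpr ((chart_mem_almostProdOpen_iff 1 x).mp hy)⟩, rfl⟩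

end almostProdComplement

/-! ### Spanning trees of the banana graph. -/

section graph

open MvPolynomial

/-- Connectedness forces an edge between the two vertices and simplicity forbids a second one. -/
lemma exists_isSpanningTree_bananaGraph_iff (n : ℕ) (S : Finset (Fin n)) :
    (∃ T : Graph (Fin 2) (Fin n), IsSpanningTree T (bananaGraph n) ∧
      T.edgeSet = (↑S : Set (Fin n))) ↔
      ∃ e, S = {e} := by
  constructor
  · rintro ⟨T, ⟨hT, hsimple, htree⟩, hS⟩
    have hV : T.vertexSet = {0, 1} := hT.vertexSet_eq
    have hlink {e x y} (h : T.IsLink e x y) : T.IsLink e 0 1 := by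
      have h' := h.mono hT.le
      rw [bananaGraph, Graph.banana_isLink] at h'
      obtain ⟨-, ⟨rfl, rfl⟩ | ⟨rfl, rfl⟩⟩ := h'
      · exact h
      · exact h.symm
    obtain ⟨w⟩ := htree.connected.preconnected ⟨0, by simp [hV]⟩ ⟨1, by simp [hV]⟩
    obtain ⟨e, he⟩ : ∃ e, T.IsLink e 0 1 := by
      cases w with
      | cons h _ =>
        obtain ⟨-, e, he⟩ := h
        exact ⟨e, hlink he⟩
    refine ⟨e, Finset.eq_singleton_iff_unique_mem.mpr ⟨?_, fun f hf => ?_⟩⟩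
    · rw [← Finset.mem_coe, ← hS]
      exact he.edge_mem
    · rw [← Finset.mem_coe, ← hS] at hf
      obtain ⟨x, y, hxy⟩ := Graph.exists_isLink_of_mem_edgeSet hf
      exact hsimple.eq_of_isLink (hlink hxy) he
  · rintro ⟨e, rfl⟩
    refine ⟨Graph.banana 0 1 {e},
      ⟨Graph.IsSpanningSubgraph.banana_mono (Set.subset_univ _), ?_, ?_⟩, by simp⟩
    · refine { not_isLoopAt := fun f x h => ?_, eq_of_isLink := fun f g x y hf hg => ?_ }
      · simp at h
      · rw [Graph.banana_isLink] at hf hg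
        exact hf.1.trans hg.1.symm
    · set T : Graph (Fin 2) (Fin n) := Graph.banana 0 1 {e} with hT
      have hne : Nonempty T.vertexSet := ⟨⟨0, by simp [hT]⟩⟩
      refine ⟨⟨fun x y => ?_⟩, fun x c hc => ?_⟩
      · by_cases hxy : x = y
        · rw [hxy]
        · refine SimpleGraph.Adj.reachable ⟨hxy, ?_⟩
          refine Graph.banana_adj.mpr ?_
          refine ⟨Set.singleton_nonempty e, ?_⟩
          have : x.1 ≠ y.1 := fun h => hxy (Subtype.ext h)
          revert this
          generalize x.1 = a
          generalize y.1 = b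
          revert a b
          decide
      -- A cycle would need three distinct vertices, and there are only two.
      · have := Fintype.ofFinite T.vertexSet
        have h₁ := hc.three_le_length
        have h₂ := hc.support_nodup.length_le_card
        have h₃ : Fintype.card T.vertexSet ≤ 2 := by
          simpa using Fintype.card_subtype_le (· ∈ T.vertexSet)
        rw [List.length_tail, SimpleGraph.Walk.length_support] at h₂
        omega

lemma kirchhoffPolynomial_bananaGraph (K : Type u) [Field K] (n : ℕ) :
    kirchhoffPolynomial K (bananaGraph n) = almostProd X := by
  classical
  rw [kirchhoffPolynomial, almostProd]
  simp_rw [exists_isSpanningTree_bananaGraph_iff]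
  have : (Finset.univ : Finset (Finset (Fin n))).filter (fun S => ∃ e, S = {e}) =
      Finset.univ.image (fun e => ({e} : Finset (Fin n))) := by
    ext S
    simp [eq_comm]
  rw [this, Finset.sum_image (fun a _ b _ h => Finset.singleton_injective h)]
  refine Finset.sum_congr rfl fun e _ => ?_
  rw [Finset.prod_filter]
  refine Finset.prod_congr rfl fun i _ => ?_
  simp [bananaGraph, ite_not]

end graph

/-! ### Binomial and geometric sum identities. -/

section identities

variable {S : Type*} [CommRing S]

lemma sum_choose_succ (L : S) (N : ℕ) :
    (L - 1) ^ N = ∑ k ∈ Finset.range N, (N.choose (k + 1) : S) * (-1) ^ (N - 1 - k) * L ^ (k + 1)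
      + (-1) ^ N := by
  rw [sub_eq_add_neg, add_pow, Finset.sum_range_succ']
  congr 1
  · refine Finset.sum_congr rfl fun k _ => ?_
    rw [show N - (k + 1) = N - 1 - k by omega]
    ring
  · simp

/-- The factor `L - 1` turns each geometric sum into `L ^ (k + 1) - 1`; the result is the binomial
expansion at `L` minus the one at `1`, which is zero. -/
lemma sum_choose_succ_mul_geom_sum (L : S) (N : ℕ) (hN : N ≠ 0) :
    (L - 1) * ∑ k ∈ Finset.range N, (N.choose (k + 1) : S) * (-1) ^ (N - 1 - k) *
      ∑ i ∈ Finset.range (k + 1), L ^ i = (L - 1) ^ N := by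
  have h₁ := sum_choose_succ L N
  have h₂ := sum_choose_succ (1 : S) N
  simp only [sub_self, zero_pow hN, one_pow, mul_one] at h₂
  calc _ = ∑ k ∈ Finset.range N, ((N.choose (k + 1) : S) * (-1) ^ (N - 1 - k) * L ^ (k + 1) -
        (N.choose (k + 1) : S) * (-1) ^ (N - 1 - k)) := by
        rw [Finset.mul_sum]
        refine Finset.sum_congr rfl fun k _ => ?_
        have := mul_geom_sum L (k + 1)
        linear_combination ((N.choose (k + 1) : S) * (-1) ^ (N - 1 - k)) * this
    _ = _ := by
        rw [Finset.sum_sub_distrib]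
        linear_combination -h₁ + h₂

lemma sum_choose_add_two_mul_geom_sum (L : S) (n : ℕ) :
    (L - 1) * (L * ∑ k ∈ Finset.range n, ((n + 1).choose (k + 2) : S) * (-1) ^ (n - 1 - k) *
      ∑ i ∈ Finset.range (k + 1), L ^ i) = (L - 1) * ((L - 1) ^ n - (-1) ^ n) := by
  have h (x : S) : (x - 1) ^ (n + 1) = ∑ k ∈ Finset.range n,
      ((n + 1).choose (k + 2) : S) * (-1) ^ (n - 1 - k) * x ^ (k + 2) +
        (n + 1) * (-1) ^ n * x + (-1) ^ (n + 1) := by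
    rw [sum_choose_succ x (n + 1), Finset.sum_range_succ']
    congr 2
    · refine Finset.sum_congr rfl fun k _ => ?_
      rw [show n + 1 - 1 - (k + 1) = n - 1 - k by omega]
    · simp
  have h₁ := h L
  have h₂ := h 1
  simp only [sub_self, zero_pow (Nat.succ_ne_zero n), one_pow, mul_one] at h₂
  calc _ = ∑ k ∈ Finset.range n, (((n + 1).choose (k + 2) : S) * (-1) ^ (n - 1 - k) * L ^ (k + 2) -
        L * (((n + 1).choose (k + 2) : S) * (-1) ^ (n - 1 - k))) := by
        rw [Finset.mul_sum, Finset.mul_sum]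
        refine Finset.sum_congr rfl fun k _ => ?_
        have := mul_geom_sum L (k + 1)
        linear_combination (L * ((n + 1).choose (k + 2) : S) * (-1) ^ (n - 1 - k)) * this
    _ = _ := by
        rw [Finset.sum_sub_distrib, ← Finset.mul_sum]
        -- Multiplying the expansion at `1` by `L` makes the linear terms cancel.
        linear_combination -h₁ + L * h₂

end identities

open Polynomial in
/-- The polynomial `q` with `(x + 1) q = x ^ n - (-1) ^ n`. -/
def alternatingSum (n : ℕ) : ℤ[X] := ∑ k ∈ Finset.range n, (-1) ^ (n - 1 - k) * X ^ k

open Polynomial in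
lemma X_add_one_mul_alternatingSum (n : ℕ) :
    (X + 1) * alternatingSum n = X ^ n - (-1) ^ n := by
  have h := (Commute.all (X : ℤ[X]) (-1)).mul_geom_sum₂ n
  rw [sub_neg_eq_add] at h
  rw [← h, alternatingSum]
  simp only [mul_comm]

-- Stated over the domain `ℤ[X]`, where the factors `X` and `X + 1` can be cancelled; this is not
-- possible in a general commutative ring.
open Polynomial in
lemma sum_choose_add_two_eq_alternatingSum (n : ℕ) :
    ∑ k ∈ Finset.range n, ((n + 1).choose (k + 2) : ℤ[X]) * (-1) ^ (n - 1 - k) *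
      ∑ i ∈ Finset.range (k + 1), (X + 1) ^ i = alternatingSum n := by
  have h := sum_choose_add_two_mul_geom_sum (X + 1 : ℤ[X]) n
  rw [add_sub_cancel_right, ← X_add_one_mul_alternatingSum] at h
  exact mul_left_cancel₀ (X_add_C_ne_zero 1) (mul_left_cancel₀ X_ne_zero h)

open Polynomial in
lemma sum_choose_succ_eq_X_pow (n : ℕ) :
    ∑ k ∈ Finset.range (n + 1), ((n + 1).choose (k + 1) : ℤ[X]) * (-1) ^ (n - k) *
      ∑ i ∈ Finset.range (k + 1), (X + 1) ^ i = X ^ n := by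
  have h := sum_choose_succ_mul_geom_sum (X + 1 : ℤ[X]) (n + 1) (Nat.succ_ne_zero n)
  rw [add_sub_cancel_right, pow_succ'] at h
  exact mul_left_cancel₀ X_ne_zero h

/-! ### The class of the banana complement. -/

variable {K : Type u} [Field K]

lemma aeval_alternatingSum {R : Type*} [CommRing R] [Algebra ℤ R] (t : R) (n : ℕ) :
    Polynomial.aeval t (alternatingSum n) =
      ∑ k ∈ Finset.range n, (-1) ^ (n - 1 - k) * t ^ k := by
  simp [alternatingSum]

/-- The class of the complement of the hypersurface defined by the banana graph. -/
lemma classOf_bananaComplement (m : ℕ) :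
    classOf (bananaComplement K (m + 2)) =
      Polynomial.aeval (torusClass K) (alternatingSum (m + 2)) +
        ((m + 2 : ℕ) : GrothendieckRing K) * torusClass K ^ m := by
  have h : bananaComplement K (m + 2) = openSubvariety K (m + 2) (almostProdOpen K m) := by
    rw [bananaComplement, kirchhoffPolynomial_bananaGraph, hypersurfaceComplement]
    congr 1
    exact TopologicalSpace.Opens.ext
      (ProjectiveSpectrum.basicOpen_eq_zeroLocus_compl (grading K (m + 2)) _).symm
  rw [h, classOf_almostProdOpen, locClass_dehomogenized, locClass_prod_X_mul_dehomogenized,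
    aeval_alternatingSum, show m + 2 - 1 = m + 1 from rfl]
  push_cast
  ring

end BananaMotive

end

theorem mainTheorem11 (K : Type u) [Field K] (n : ℕ) (hn : 2 ≤ n) :
    (∃ q : Polynomial ℤ,
      (Polynomial.X + 1) * q = Polynomial.X ^ n - (-1) ^ n ∧
      BananaMotive.classOf (BananaMotive.bananaComplement K n) =
        Polynomial.aeval (BananaMotive.torusClass K) q
          + (n : BananaMotive.GrothendieckRing K) * BananaMotive.torusClass K ^ (n - 2)) ∧
    BananaMotive.classOf (BananaMotive.bananaComplement K n) =
      BananaMotive.torusClass K ^ (n - 1)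
        + ((n : BananaMotive.GrothendieckRing K) - 1) * BananaMotive.torusClass K ^ (n - 2)
        + ∑ k ∈ Finset.range (n - 2), (-1) ^ (n - 3 - k) * BananaMotive.torusClass K ^ k ∧
    BananaMotive.classOf (BananaMotive.bananaComplement K n) =
      ∑ k ∈ Finset.range n,
          ((n + 1).choose (k + 2) : BananaMotive.GrothendieckRing K) * (-1) ^ (n - 1 - k)
            * BananaMotive.classOf (BananaMotive.projectiveSpace K k)
        + (n : BananaMotive.GrothendieckRing K) *
          ∑ k ∈ Finset.range (n - 1),
            ((n - 1).choose (k + 1) : BananaMotive.GrothendieckRing K) * (-1) ^ (n - 2 - k)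
              * BananaMotive.classOf (BananaMotive.projectiveSpace K k) := by
  obtain ⟨m, rfl⟩ := Nat.exists_eq_add_of_le' hn
  have h := BananaMotive.classOf_bananaComplement (K := K) m
  refine ⟨⟨BananaMotive.alternatingSum (m + 2), BananaMotive.X_add_one_mul_alternatingSum _, h⟩,
    ?_, ?_⟩
  -- The two top terms are `𝕋^(m+1) - 𝕋^m`, which lowers the coefficient `n` to `n - 1`. The
  -- remaining exponents of `-1` drop by two; the truncated `n - 3` matters only for `n = 2`, where
  -- the sum is empty.
  · rw [h, BananaMotive.aeval_alternatingSum, Finset.sum_range_succ, Finset.sum_range_succ]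
    have hs : ∑ k ∈ Finset.range m, (-1) ^ (m + 2 - 1 - k) * BananaMotive.torusClass K ^ k =
        ∑ k ∈ Finset.range m, (-1) ^ (m + 2 - 3 - k) * BananaMotive.torusClass K ^ k := by
      refine Finset.sum_congr rfl fun k hk => ?_
      rw [Finset.mem_range] at hk
      rw [show m + 2 - 1 - k = m + 2 - 3 - k + 2 by omega, pow_add, neg_one_sq, mul_one]
    rw [hs]
    simp only [Nat.add_sub_cancel, show m + 2 - 1 = m + 1 from rfl, Nat.sub_self,
      show m + 1 - m = 1 by omega]
    ring
  · rw [h, ← BananaMotive.sum_choose_add_two_eq_alternatingSum]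
    have h₂ := congrArg (Polynomial.aeval (BananaMotive.torusClass K))
      (BananaMotive.sum_choose_succ_eq_X_pow m)
    rw [map_pow, Polynomial.aeval_X] at h₂
    rw [← h₂]
    simp only [BananaMotive.classOf_projectiveSpace, map_sum, map_mul, map_pow, map_add, map_neg,
      map_one, map_natCast, Polynomial.aeval_X, Nat.add_sub_cancel, show m + 2 - 1 = m + 1 from rfl]
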